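/- Let $E$ be a measurable space, $\theta>0$, $\nu$ a probability measure on $E$, and $R$ a transition kernel on $E$ with $R_x(E)<\infty$ for all $x$. A sequence $(X_n)_{n\ge1}$ of $E$-valued random variables is called a measure-valued P\'olya sequence, MVPS$(\theta,\nu,R)$, if $X_1\sim\nu$ and, for every $n\ge1$, \[\mathbb{P}(X_{n+1}\in\cdot\mid X_1,\dots,X_n)=\frac{\theta\nu(\cdot)+\sum_{i=1}^nR_{X_i}(\cdot)}{\theta+\sum_{i=1}^nR_{X_i}(E)};\] it is a (Blackwell--MacQueen) P\'olya sequence with parameters $(\theta,\nu)$ if $R_x=\delta_x$. Let $(\mathbb{X},\mathcal{X})$ be a standard Borel space and $\nu$ a probability measure on it. For a sub-$\sigma$-algebra $\mathcal{G}\subseteq\mathcal{X}$, let $[x]_{\mathcal{G}}=\bigcap_{G\in\mathcal{G},\,x\in G}G$ be its atom at $x$, let $\Pi=\{[x]_{\mathcal{G}}:x\in\mathbb{X}\}$ and $\pi:\mathbb{X}\to\Pi$, $\pi(x)=[x]_{\mathcal{G}}$, and equip $\Pi$ with the $\sigma$-algebra $\{S\subseteq\Pi:\pi^{-1}(S)\in\mathcal{G}\}$.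 Call $\mathcal{G}$ countably generated under $\nu$ if there is $C\in\mathcal{G}$ with $\nu(C)=1$ such that the trace $\mathcal{G}\cap C$ is countably generated. Let $(X_n)_{n\ge1}$ be an exchangeable MVPS$(\theta,\nu,R)$ with values in $\mathbb{X}$. Put $Z=\{x:R_x(\mathbb{X})=0\}$, and suppose that the parametrization is canonical, i.e. $R_x(\mathbb{X})=1$ for all $x\notin Z$, and that the reinforcement is strictly positive, i.e. $\nu(Z)=0$. Then there exists a sub-$\sigma$-algebra $\mathcal{G}\subseteq\mathcal{X}$, countably generated under $\nu$, such that \[\frac{R_x(\cdot)}{R_x(\mathbb{X})}=\nu(\cdot\mid\mathcal{G})(x)\qquad\text{for $\nu$-a.e. }x,\] where $\nu(\cdot\mid\mathcal{G})$ is the regular conditional distribution of $\nu$ given $\mathcal{G}$. Moreover, for every such $\mathcal{G}$, with $\pi$ the associated map to atoms, the sequence $(\pi(X_n))_{n\ge1}$ is a P\'olya sequence with parameters $(\theta,\nu\circ\pi^{-1})$. -/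

import Mathlib

open MeasureTheory ProbabilityTheory

namespace MVPS

section Sequences

variable {Ω E : Type*} [MeasurableSpace Ω] [MeasurableSpace E]

/-- A sequence `X 0, X 1, …` of random variables is exchangeable under `P`: the joint law of the
first `n` of them is invariant under all permutations, for every `n`. -/
def Exchangeable (P : Measure Ω) (X : ℕ → Ω → E) : Prop :=
  ∀ (n : ℕ) (σ : Equiv.Perm (Fin n)),
    P.map (fun ω (i : Fin n) => X (σ i) ω) = P.map (fun ω (i : Fin n) => X i ω)

/-- The sub-σ-algebra of `Ω` generated by the first `n` observations `X 0, …, X (n - 1)`. -/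
@[reducible] def pastSigma (X : ℕ → Ω → E) (n : ℕ) : MeasurableSpace Ω :=
  MeasurableSpace.comap (fun ω (i : Fin n) => X i ω) inferInstance

/-- `X` is a measure-valued Pólya sequence with parameters `θ`, `ν`, `R` under `P`. The sequence is
indexed from `0`, so that `X n` is the `(n+1)`-st observation. The reinforcement kernel `R` is
finite in the sense that every `R x` is a finite measure (no uniform bound is required).
The predictive distribution of `X n` given `X 0, …, X (n - 1)` is
`(θ ν + ∑ i < n, R (X i)) / (θ + ∑ i < n, R (X i) E)`, that is, the value of this random
probability measure at each measurable set `A` is a version of the conditional probability of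
`{X n ∈ A}`. -/
structure IsMVPS (P : Measure Ω) (θ : ℝ) (ν : Measure E) (R : Kernel E E) (X : ℕ → Ω → E) :
    Prop where
  theta_pos : 0 < θ
  prob : IsProbabilityMeasure ν
  finite : ∀ x, IsFiniteMeasure (R x)
  measurable : ∀ n, Measurable (X n)
  law_zero : P.map (X 0) = ν
  predictive : ∀ n, 1 ≤ n → ∀ A : Set E, MeasurableSet A →
    P⟦X n ⁻¹' A | pastSigma X n⟧ =ᵐ[P] fun ω =>
      (θ * ν.real A + ∑ i ∈ Finset.range n, (R (X i ω)).real A) /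
        (θ + ∑ i ∈ Finset.range n, (R (X i ω)).real Set.univ)

/-- A Blackwell–MacQueen Pólya sequence with parameters `θ`, `ν`: a measure-valued Pólya sequence
whose reinforcement at `x` is the unit mass at `x` (`Kernel.id x = Measure.dirac x`). -/
def IsPolyaSequence (P : Measure Ω) (θ : ℝ) (ν : Measure E) (X : ℕ → Ω → E) : Prop :=
  IsMVPS P θ ν Kernel.id X

/-- The set `Z` of points at which the reinforcement vanishes. -/
def nullSet (R : Kernel E E) : Set E := {x | R x Set.univ = 0}

/-- The reinforcement is strictly positive: `ν Z = 0`. -/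
def StrictlyPositive (ν : Measure E) (R : Kernel E E) : Prop := ν (nullSet R) = 0

/-- The parametrization is canonical: `R x` has total mass one for every `x` outside `Z`. -/
def Canonical (R : Kernel E E) : Prop := ∀ x, x ∉ nullSet R → R x Set.univ = 1

end Sequences

section Atoms

variable {E : Type*}

/-- The set `Π` of all atoms `[x] = ⋂ {G ∈ 𝒢, x ∈ G} G` of the σ-algebra `𝒢`. -/
def AtomSpace (𝒢 : MeasurableSpace E) : Type _ := Set.range (@measurableAtom E 𝒢)

/-- The map `π` that sends a point to its `𝒢`-atom. -/
def atomMap (𝒢 : MeasurableSpace E) (x : E) : AtomSpace 𝒢 :=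
  ⟨@measurableAtom E 𝒢 x, Set.mem_range_self x⟩

/-- The σ-algebra `{S ⊆ Π : π⁻¹ S ∈ 𝒢}` on the set of atoms. -/
instance (𝒢 : MeasurableSpace E) : MeasurableSpace (AtomSpace 𝒢) :=
  MeasurableSpace.map (atomMap 𝒢) 𝒢

theorem measurableSet_atomSpace_iff (𝒢 : MeasurableSpace E) (S : Set (AtomSpace 𝒢)) :
    MeasurableSet S ↔ MeasurableSet[𝒢] (atomMap 𝒢 ⁻¹' S) := Iff.rfl

theorem measurable_atomMap {𝒢 mE : MeasurableSpace E} (h : 𝒢 ≤ mE) :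
    Measurable[mE] (atomMap 𝒢) := fun _ hS => h _ hS

/-- The image `ν ∘ π⁻¹` on the set of atoms of a measure `ν` on `E`. -/
noncomputable def atomMeasure {mE : MeasurableSpace E} (ν : Measure E) (𝒢 : MeasurableSpace E) :
    Measure (AtomSpace 𝒢) := @Measure.map E (AtomSpace 𝒢) mE _ (atomMap 𝒢) ν

end Atoms

section Conditioning

variable {E : Type*} {mE : MeasurableSpace E}

/-- `𝒢` is countably generated under `ν`: for some `C ∈ 𝒢` with `ν C = 1`, the trace of `𝒢`
on `C` is countably generated. -/
def CountablyGeneratedUnder (ν : Measure E) (𝒢 : MeasurableSpace E) : Prop :=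
  ∃ C : Set E, MeasurableSet[𝒢] C ∧ ν C = 1 ∧
    @MeasurableSpace.CountablyGenerated C (𝒢.comap Subtype.val)

/-- `𝒢` is a conditioning σ-algebra for the reinforcement kernel `R`: a sub-σ-algebra, countably
generated under `ν`, such that the normalized reinforcement `R x / R x E` is, for `ν`-a.e. `x`,
the regular conditional distribution `ν(· | 𝒢)(x)`. -/
structure IsConditioning [StandardBorelSpace E] (ν : Measure E) [IsFiniteMeasure ν]
    (R : Kernel E E) (𝒢 : MeasurableSpace E) : Prop where
  le : 𝒢 ≤ mE
  countablyGenerated : CountablyGeneratedUnder ν 𝒢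
  ae_eq : ∀ᵐ x ∂ν, (R x Set.univ)⁻¹ • R x = condExpKernel (mΩ := mE) ν 𝒢 x

end Conditioning

end MVPS

namespace MVPS

/-! Almost surely every reinforcement has mass one, so the predictive law is `(θ ν + ∑ R (X i)) / (θ
+ n)`. Exchangeability then makes `R`, acting on functions by integration, an orthogonal projection
of L²(ν). Swapping the first two observations makes `ν ⊗ₘ R` symmetric (`IsMVPS.reversible`);
equality in law of `(X 0, X 2)` and `(X 0, X 1)` gives `R² = R` (`IsMVPS.idempotent`).

A Markov projection is a conditional expectation: its fixed functions are constant along the kernel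
(`ae_eq_compProd_of_invariant`), and countably many of the functions `x ↦ R x A` generate the
required 𝒢.

Conversely, for any conditioning 𝒢 and `B ∈ 𝒢`, `R x B` is a.e. the indicator of `B`. On 𝒢 the
predictive law is thus that of a Pólya sequence, and the tower property passes to the past of the
atoms. -/

theorem measurable_real_coe {E : Type*} {mE : MeasurableSpace E} {R : Kernel E E} {A : Set E}
    (hA : MeasurableSet A) : Measurable fun x => (R x).real A :=
  (R.measurable_coe hA).ennreal_toReal

/-! ### Reversible idempotent Markov kernels as conditional distributions -/

section Projection

variable {E : Type*} {mE : MeasurableSpace E} {ν : Measure E} [IsProbabilityMeasure ν]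
  {R : Kernel E E} [IsFiniteKernel R]

theorem integrable_comp_real_coe {F : Type*} {mF : MeasurableSpace F} (μ : Measure F)
    [IsFiniteMeasure μ] {f : F → E} (hf : Measurable f) {A : Set E} (hA : MeasurableSet A) :
    Integrable (fun x => (R (f x)).real A) μ := by
  refine Integrable.of_bound (C := R.bound.toReal)
    ((R.measurable_coe hA).comp hf).ennreal_toReal.aestronglyMeasurable (ae_of_all _ fun x => ?_)
  rw [Real.norm_of_nonneg measureReal_nonneg]
  exact ENNReal.toReal_mono R.bound_ne_top (R.measure_le_bound _ _)

theorem compProd_real_prod {A B : Set E} (hA : MeasurableSet A)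
    (hB : MeasurableSet B) :
    (ν ⊗ₘ R).real (B ×ˢ A) = ∫ x in B, (R x).real A ∂ν := by
  rw [measureReal_def, Measure.compProd_apply_prod hB hA,
    ← integral_toReal (R.measurable_coe hA).aemeasurable
      (ae_of_all _ fun x => measure_lt_top _ _)]
  rfl

theorem map_fst_compProd_of_ae_univ (hR : ∀ᵐ x ∂ν, R x Set.univ = 1) :
    (ν ⊗ₘ R).map Prod.fst = ν := by
  ext s hs
  rw [Measure.map_apply measurable_fst hs, ← Set.prod_univ,
    Measure.compProd_apply_prod hs MeasurableSet.univ,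
    lintegral_congr_ae (ae_restrict_of_ae hR)]
  simp

theorem map_snd_compProd_of_reversible (hR : ∀ᵐ x ∂ν, R x Set.univ = 1)
    (hrev : (ν ⊗ₘ R).map Prod.swap = ν ⊗ₘ R) : (ν ⊗ₘ R).map Prod.snd = ν := by
  conv_lhs => rw [← hrev]
  rw [Measure.map_map measurable_snd measurable_swap]
  exact map_fst_compProd_of_ae_univ hR

/-- A function in the range of a reversible Markov projection is constant along the kernel. -/
theorem ae_eq_compProd_of_invariant (hR : ∀ᵐ x ∂ν, R x Set.univ = 1)
    (hrev : (ν ⊗ₘ R).map Prod.swap = ν ⊗ₘ R) {h : E → ℝ} (hm : Measurable h) {C : ℝ}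
    (hC : ∀ x, ‖h x‖ ≤ C) (hinv : ∀ᵐ x ∂ν, ∫ y, h y ∂(R x) = h x) :
    ∀ᵐ p ∂(ν ⊗ₘ R), h p.1 = h p.2 := by
  have hb : ∀ x y, ‖h x * h y‖ ≤ C * C := fun x y => by
    rw [norm_mul]
    exact mul_le_mul (hC x) (hC y) (norm_nonneg _) ((norm_nonneg _).trans (hC x))
  have i1 : Integrable (fun p : E × E => h p.1 * h p.1) (ν ⊗ₘ R) :=
    .of_bound (by fun_prop) (C * C) (ae_of_all _ fun p => hb _ _)
  have i2 : Integrable (fun p : E × E => h p.1 * h p.2) (ν ⊗ₘ R) :=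
    .of_bound (by fun_prop) (C * C) (ae_of_all _ fun p => hb _ _)
  have i3 : Integrable (fun p : E × E => h p.2 * h p.2) (ν ⊗ₘ R) :=
    .of_bound (by fun_prop) (C * C) (ae_of_all _ fun p => hb _ _)
  have hsq : ∀ {g : E × E → E}, Measurable g → (ν ⊗ₘ R).map g = ν →
      ∫ p, h (g p) * h (g p) ∂(ν ⊗ₘ R) = ∫ x, h x * h x ∂ν := fun {g} hg hg' => by
    conv_rhs => rw [← hg']
    rw [integral_map hg.aemeasurable (by fun_prop)]
  have e1 := hsq measurable_fst (map_fst_compProd_of_ae_univ hR)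
  have e3 := hsq measurable_snd (map_snd_compProd_of_reversible hR hrev)
  have e2 : ∫ p, h p.1 * h p.2 ∂(ν ⊗ₘ R) = ∫ x, h x * h x ∂ν := by
    rw [Measure.integral_compProd i2]
    refine integral_congr_ae ?_
    filter_upwards [hinv] with x hx
    rw [integral_const_mul, hx]
  have i4 : Integrable (fun p : E × E => h p.1 * h p.1 - 2 * (h p.1 * h p.2)) (ν ⊗ₘ R) :=
    i1.sub (i2.const_mul 2)
  have hexp : (fun p : E × E => h p.1 * h p.1 - 2 * (h p.1 * h p.2) + h p.2 * h p.2) =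
      fun p => (h p.1 - h p.2) ^ 2 := by
    funext p; ring
  have hi : Integrable (fun p : E × E =>
      h p.1 * h p.1 - 2 * (h p.1 * h p.2) + h p.2 * h p.2) (ν ⊗ₘ R) := i4.add i3
  -- Both marginals are `ν` and `h` is fixed by `R`, so all three terms of the expanded square equal
  -- `∫ h²`, with coefficients 1, -2, 1.
  have hz : ∫ p, (h p.1 - h p.2) ^ 2 ∂(ν ⊗ₘ R) = 0 := by
    rw [← hexp, integral_add i4 i3, integral_sub i1 (i2.const_mul 2), integral_const_mul, e1, e2,
      e3]
    ring
  rw [hexp] at hi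
  filter_upwards [(integral_eq_zero_iff_of_nonneg (fun p => sq_nonneg _) hi).1 hz] with p hp
  exact sub_eq_zero.1 (pow_eq_zero_iff two_ne_zero |>.1 hp)

theorem exists_countable_isPiSystem_generateFrom [h : MeasurableSpace.CountablyGenerated E] :
    ∃ S : Set (Set E), S.Countable ∧ IsPiSystem S ∧ mE = MeasurableSpace.generateFrom S := by
  obtain ⟨b, hb, rfl⟩ := h.isCountablyGenerated
  exact ⟨generateSetAlgebra b, countable_generateSetAlgebra hb,
    fun s hs t ht _ => isSetAlgebra_generateSetAlgebra.inter_mem hs ht,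
    generateFrom_generateSetAlgebra_eq.symm⟩

/-- A reversible idempotent Markov kernel is a regular conditional distribution given a countably
generated sub-σ-algebra. -/
theorem exists_isConditioning_of_reversible_idempotent [StandardBorelSpace E]
    (hR : ∀ᵐ x ∂ν, R x Set.univ = 1) (hrev : (ν ⊗ₘ R).map Prod.swap = ν ⊗ₘ R)
    (hidem : ∀ A, MeasurableSet A → ∀ᵐ x ∂ν, ∫ y, (R y).real A ∂(R x) = (R x).real A) :
    ∃ 𝒢 : MeasurableSpace E, IsConditioning ν R 𝒢 := by
  obtain ⟨S, hS, hpi, hgen⟩ := exists_countable_isPiSystem_generateFrom (mE := mE)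
  have hSm : ∀ A ∈ S, MeasurableSet A := fun A hA => by
    rw [hgen]; exact MeasurableSpace.measurableSet_generateFrom hA
  have := hS.to_subtype
  -- A countable index set keeps the σ-algebra generated by `Φ` countably generated and lets null
  -- sets be united.
  let Φ : E → S → ℝ := fun x A => (R x).real A
  have hΦ : Measurable Φ := measurable_pi_lambda _ fun A => measurable_real_coe (hSm A A.2)
  have hle : MeasurableSpace.comap Φ inferInstance ≤ mE := hΦ.comap_le
  refine ⟨MeasurableSpace.comap Φ inferInstance, hle, ?_, ?_⟩
  · refine ⟨Set.univ, MeasurableSet.univ, measure_univ, ?_⟩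
    have : @MeasurableSpace.CountablyGenerated E (MeasurableSpace.comap Φ inferInstance) :=
      MeasurableSpace.CountablyGenerated.comap Φ
    exact @MeasurableSpace.CountablyGenerated.comap _ _ (MeasurableSpace.comap Φ inferInstance)
      this _
  have hconst : ∀ᵐ p ∂(ν ⊗ₘ R), Φ p.1 = Φ p.2 := by
    have : ∀ A : S, ∀ᵐ p ∂(ν ⊗ₘ R), Φ p.1 A = Φ p.2 A := fun A =>
      ae_eq_compProd_of_invariant hR hrev (measurable_real_coe (hSm A A.2)) (C := R.bound.toReal)
        (fun x => by
          rw [Real.norm_of_nonneg measureReal_nonneg]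
          exact ENNReal.toReal_mono R.bound_ne_top (R.measure_le_bound _ _))
        (hidem A (hSm A A.2))
    filter_upwards [ae_all_iff.2 this] with p hp using funext hp
  have hset : ∀ A, MeasurableSet A → ∀ B, MeasurableSet[MeasurableSpace.comap Φ inferInstance] B →
      ∫ x in B, (R x).real A ∂ν = ν.real (B ∩ A) := fun A hA B hB => by
    have hB' := hle B hB
    have h1 : (ν ⊗ₘ R) (B ×ˢ A) = ν (B ∩ A) := by
      -- `B` is a preimage under `Φ`, which agrees at both coordinates, so the constraint `p.1 ∈ B`
      -- can be moved to `p.2`.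
      have h2 : (ν ⊗ₘ R) (B ×ˢ A) = (ν ⊗ₘ R) (Prod.snd ⁻¹' (B ∩ A)) := by
        refine measure_congr ?_
        obtain ⟨T, -, rfl⟩ := hB
        filter_upwards [hconst] with p hp
        refine propext ?_
        change (Φ p.1 ∈ T ∧ p.2 ∈ A) ↔ (Φ p.2 ∈ T ∧ p.2 ∈ A)
        rw [hp]
      rw [h2, ← Measure.map_apply measurable_snd (hB'.inter hA),
        map_snd_compProd_of_reversible hR hrev]
    rw [← compProd_real_prod hA hB', measureReal_def, h1, measureReal_def]
  have hcond : ∀ A ∈ S, ∀ᵐ x ∂ν,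
      (R x).real A = (condExpKernel ν (MeasurableSpace.comap Φ inferInstance) x).real A :=
    fun A hA => by
      have hA' := hSm A hA
      refine Filter.EventuallyEq.trans ?_ (condExpKernel_ae_eq_condExp hle hA').symm
      refine ae_eq_condExp_of_forall_setIntegral_eq hle
        ((integrable_const (1 : ℝ)).indicator hA')
        (fun B _ _ => (integrable_comp_real_coe ν measurable_id hA').integrableOn)
        (fun B hB _ => ?_) ?_
      · rw [hset A hA' B hB, setIntegral_indicator hA']
        simp
      · have : Measurable[MeasurableSpace.comap Φ inferInstance] fun x => (R x).real A :=
          (measurable_pi_apply (⟨A, hA⟩ : S)).comp (comap_measurable Φ)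
        exact this.stronglyMeasurable.aestronglyMeasurable
  filter_upwards [hR, (ae_ball_iff hS).2 hcond] with x hx hx'
  rw [hx, inv_one, one_smul]
  refine ext_of_generate_finite S hgen hpi (fun A hA => ?_) ?_
  · exact (ENNReal.toReal_eq_toReal_iff' (measure_ne_top _ _) (measure_ne_top _ _)).1 (hx' A hA)
  · rw [hx, measure_univ]

end Projection

/-! ### Two-dimensional laws under exchangeability -/

section Exchangeability

variable {Ω E : Type*} [MeasurableSpace Ω] {mE : MeasurableSpace E} {P : Measure Ω}
  {X : ℕ → Ω → E}

theorem Exchangeable.map_comp {F : Type*} [MeasurableSpace F] (hX : Exchangeable P X)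
    (hm : ∀ n, Measurable (X n)) {n : ℕ} (σ : Equiv.Perm (Fin n)) {g : (Fin n → E) → F}
    (hg : Measurable g) :
    P.map (fun ω => g fun i => X (σ i) ω) = P.map (fun ω => g fun i => X i ω) := by
  have h := congrArg (Measure.map g) (hX n σ)
  rwa [Measure.map_map hg (measurable_pi_lambda _ fun i => hm _),
    Measure.map_map hg (measurable_pi_lambda _ fun i => hm _)] at h

theorem Exchangeable.map_eq_map_zero (hX : Exchangeable P X) (hm : ∀ n, Measurable (X n))
    (n : ℕ) : P.map (X n) = P.map (X 0) := by
  have h := hX.map_comp hm (n := n + 1) (Equiv.swap 0 (Fin.last n)) (measurable_pi_apply 0)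
  simpa using h

theorem Exchangeable.map_one_zero (hX : Exchangeable P X) (hm : ∀ n, Measurable (X n)) :
    P.map (fun ω => (X 1 ω, X 0 ω)) = P.map (fun ω => (X 0 ω, X 1 ω)) := by
  have h := hX.map_comp hm (n := 2) (Equiv.swap 0 1)
    ((measurable_pi_apply 0).prodMk (measurable_pi_apply 1))
  simpa using h

theorem Exchangeable.map_zero_two (hX : Exchangeable P X) (hm : ∀ n, Measurable (X n)) :
    P.map (fun ω => (X 0 ω, X 2 ω)) = P.map (fun ω => (X 0 ω, X 1 ω)) := by
  have h := hX.map_comp hm (n := 3) (Equiv.swap 1 2)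
    ((measurable_pi_apply 0).prodMk (measurable_pi_apply 1))
  have e : Equiv.swap (1 : Fin 3) 2 0 = 0 := by decide
  simpa [e] using h

end Exchangeability

theorem measurable_pastSigma {Ω E : Type*} [MeasurableSpace E] {X : ℕ → Ω → E} {n i : ℕ} (h : i < n) : Measurable[pastSigma X n] (X i) :=
  (measurable_pi_apply (⟨i, h⟩ : Fin n)).comp (comap_measurable fun ω (i : Fin n) => X i ω)

/-! ### From the predictive laws to reversibility and idempotence -/

section Predictive

variable {Ω E : Type*} [MeasurableSpace Ω] {mE : MeasurableSpace E} {P : Measure Ω}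
  {θ : ℝ} {ν : Measure E} {R : Kernel E E} {X : ℕ → Ω → E}

/-- Masses are 0 or 1, which gives the uniform bound behind the integrability arguments. -/
theorem Canonical.isFiniteKernel (h : Canonical R) : IsFiniteKernel R := by
  refine ⟨⟨1, ENNReal.one_lt_top, fun x => ?_⟩⟩
  by_cases hx : x ∈ nullSet R
  · rw [show R x Set.univ = 0 from hx]; exact zero_le_one
  · exact (h x hx).le

theorem Canonical.ae_univ_eq_one (h : Canonical R) (hpos : StrictlyPositive ν R) :
    ∀ᵐ x ∂ν, R x Set.univ = 1 := by
  have : ∀ᵐ x ∂ν, x ∉ nullSet R := measure_eq_zero_iff_ae_notMem.1 hpos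
  filter_upwards [this] with x hx using h x hx

theorem IsMVPS.map_eq (hX : IsMVPS P θ ν R X) (hexch : Exchangeable P X) (n : ℕ) :
    P.map (X n) = ν :=
  (hexch.map_eq_map_zero hX.measurable n).trans hX.law_zero

theorem IsMVPS.ae_comp (hX : IsMVPS P θ ν R X) (hexch : Exchangeable P X) {p : E → Prop}
    (hp : ∀ᵐ x ∂ν, p x) : ∀ᵐ ω ∂P, ∀ n, p (X n ω) := by
  refine ae_all_iff.2 fun n => ?_
  rw [← hX.map_eq hexch n] at hp
  exact ae_of_ae_map (hX.measurable n).aemeasurable hp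

theorem pastSigma_le (hm : ∀ n, Measurable (X n)) (n : ℕ) :
    pastSigma X n ≤ ‹MeasurableSpace Ω› :=
  (measurable_pi_lambda _ fun _ => hm _).comap_le

theorem IsMVPS.setIntegral_zero [IsFiniteKernel R] (hX : IsMVPS P θ ν R X)
    {A B : Set E} (hA : MeasurableSet A) (hB : MeasurableSet B) :
    ∫ ω in X 0 ⁻¹' B, (R (X 0 ω)).real A ∂P = ∫ x in B, (R x).real A ∂ν := by
  conv_rhs => rw [← hX.law_zero]
  rw [setIntegral_map hB (measurable_real_coe hA).aestronglyMeasurable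
    (hX.measurable 0).aemeasurable]

theorem IsMVPS.predictive_of_ae_univ (hX : IsMVPS P θ ν R X) (hexch : Exchangeable P X)
    (hR : ∀ᵐ x ∂ν, R x Set.univ = 1) {n : ℕ} (hn : 1 ≤ n) {A : Set E} (hA : MeasurableSet A) :
    P⟦X n ⁻¹' A | pastSigma X n⟧ =ᵐ[P] fun ω =>
      (θ * ν.real A + ∑ i ∈ Finset.range n, (R (X i ω)).real A) / (θ + n) := by
  filter_upwards [hX.predictive n hn A hA, hX.ae_comp hexch hR] with ω h1 h2
  rw [h1]
  simp [measureReal_def, h2]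

variable [IsProbabilityMeasure P]

/-- Integrate the predictive probability of `A` over the past event `X 0 ∈ B`. -/
theorem IsMVPS.real_inter_eq [IsFiniteKernel R] (hX : IsMVPS P θ ν R X)
    (hexch : Exchangeable P X) (hR : ∀ᵐ x ∂ν, R x Set.univ = 1) {n : ℕ} (hn : 1 ≤ n)
    {A B : Set E} (hA : MeasurableSet A) (hB : MeasurableSet B) :
    (θ + n) * P.real (X 0 ⁻¹' B ∩ X n ⁻¹' A) =
      θ * (ν.real A * ν.real B) +
        ∑ i ∈ Finset.range n, ∫ ω in X 0 ⁻¹' B, (R (X i ω)).real A ∂P := by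
  have hle := pastSigma_le hX.measurable n
  have hB0 : MeasurableSet (X 0 ⁻¹' B) := hX.measurable 0 hB
  have hAn : MeasurableSet (X n ⁻¹' A) := hX.measurable n hA
  have hθ := hX.theta_pos
  have hi : ∀ i, Integrable (fun ω => (R (X i ω)).real A) (P.restrict (X 0 ⁻¹' B)) := fun i =>
    integrable_comp_real_coe _ (hX.measurable i) hA
  have h1 := setIntegral_condExp hle ((integrable_const (μ := P) (1 : ℝ)).indicator hAn)
    (measurable_pastSigma (X := X) hn hB)
  rw [setIntegral_congr_ae hB0 ((hX.predictive_of_ae_univ hexch hR hn hA).mono fun ω h _ => h),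
    setIntegral_indicator hAn, integral_div, integral_add (integrable_const _)
    (integrable_finsetSum _ fun i _ => hi i), integral_finsetSum _ fun i _ => hi i] at h1
  have h2 : P.real (X 0 ⁻¹' B) = ν.real B := by
    rw [← hX.law_zero, map_measureReal_apply (hX.measurable 0) hB]
  rw [setIntegral_const, setIntegral_const, h2, div_eq_iff (by positivity)] at h1
  simp only [smul_eq_mul, mul_one] at h1
  linarith

variable [IsProbabilityMeasure ν]

/-- The joint law of the first two observations. -/
theorem IsMVPS.map_zero_one [IsFiniteKernel R] (hX : IsMVPS P θ ν R X)
    (hexch : Exchangeable P X) (hR : ∀ᵐ x ∂ν, R x Set.univ = 1) :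
    ENNReal.ofReal (θ + 1) • P.map (fun ω => (X 0 ω, X 1 ω)) =
      ENNReal.ofReal θ • ν.prod ν + ν ⊗ₘ R := by
  have hm : Measurable fun ω => (X 0 ω, X 1 ω) := (hX.measurable 0).prodMk (hX.measurable 1)
  have hθ := hX.theta_pos
  have := Measure.smul_finite (P.map fun ω => (X 0 ω, X 1 ω)) (ENNReal.ofReal_ne_top (r := θ + 1))
  have := Measure.smul_finite (ν.prod ν) (ENNReal.ofReal_ne_top (r := θ))
  refine Measure.ext_prod fun {B A} hB hA => ?_
  have h := hX.real_inter_eq hexch hR le_rfl hA hB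
  rw [Finset.sum_range_one, hX.setIntegral_zero hA hB, ← compProd_real_prod hA hB] at h
  rw [← ENNReal.toReal_eq_toReal_iff' (measure_ne_top _ _) (measure_ne_top _ _)]
  simp only [← measureReal_def]
  rw [measureReal_add_apply, measureReal_ennreal_smul_apply, measureReal_ennreal_smul_apply,
    ENNReal.toReal_ofReal hθ.le, ENNReal.toReal_ofReal (by positivity),
    map_measureReal_apply hm (hB.prod hA), measureReal_prod_prod]
  rw [Set.mk_preimage_prod]
  push_cast at h
  linarith

theorem IsMVPS.reversible [IsFiniteKernel R] (hX : IsMVPS P θ ν R X)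
    (hexch : Exchangeable P X) (hR : ∀ᵐ x ∂ν, R x Set.univ = 1) :
    (ν ⊗ₘ R).map Prod.swap = ν ⊗ₘ R := by
  have hm : ∀ i j, Measurable fun ω => (X i ω, X j ω) := fun i j =>
    (hX.measurable i).prodMk (hX.measurable j)
  refine Measure.ext_prod fun {A B} hA hB => ?_
  rw [Measure.map_apply measurable_swap (hA.prod hB), Set.preimage_swap_prod,
    ← ENNReal.toReal_eq_toReal_iff' (measure_ne_top _ _) (measure_ne_top _ _)]
  simp only [← measureReal_def]
  have h1 := hX.real_inter_eq hexch hR le_rfl hA hB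
  have h2 := hX.real_inter_eq hexch hR le_rfl hB hA
  rw [Finset.sum_range_one, hX.setIntegral_zero hA hB, ← compProd_real_prod hA hB] at h1
  rw [Finset.sum_range_one, hX.setIntegral_zero hB hA, ← compProd_real_prod hB hA] at h2
  have h3 := congrArg (fun μ => μ.real (A ×ˢ B)) (hexch.map_one_zero hX.measurable)
  simp only [map_measureReal_apply (hm _ _) (hA.prod hB), Set.mk_preimage_prod] at h3
  rw [Set.inter_comm] at h3
  rw [h3] at h1
  linarith

/-- Let `m = P(X 0 ∈ B, X 1 ∈ A) = P(X 0 ∈ B, X 2 ∈ A)`. Subtracting the predictive identities for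
`n = 1, 2` shows that the integral of `R (X 1) A` over `X 0 ∈ B` is `m`. Computing it from the joint
law of `(X 0, X 1)` replaces `∫_B R A` by `∫_B R² A` in the formula for `(θ + 1) m`. -/
theorem IsMVPS.idempotent [IsFiniteKernel R] (hX : IsMVPS P θ ν R X)
    (hexch : Exchangeable P X) (hR : ∀ᵐ x ∂ν, R x Set.univ = 1) {A : Set E}
    (hA : MeasurableSet A) : ∀ᵐ x ∂ν, ∫ y, (R y).real A ∂(R x) = (R x).real A := by
  have hm : ∀ i j, Measurable fun ω => (X i ω, X j ω) := fun i j =>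
    (hX.measurable i).prodMk (hX.measurable j)
  have hθ := hX.theta_pos
  have hrev := hX.reversible hexch hR
  have hi : ∀ μ : Measure (E × E), IsFiniteMeasure μ →
      Integrable (fun p : E × E => (R p.2).real A) μ := fun μ _ =>
    integrable_comp_real_coe μ measurable_snd hA
  have hRA : Integrable (fun x => ∫ y, (R y).real A ∂(R x)) ν :=
    Integrable.integral_compProd (κ := Kernel.const Unit ν) (η := Kernel.prodMkLeft Unit R)
      (a := ()) (hi (ν ⊗ₘ R) inferInstance)
  refine Integrable.ae_eq_of_forall_setIntegral_eq _ _ hRA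
    (integrable_comp_real_coe ν measurable_id hA) fun B hB _ => ?_
  -- Stationarity of `ν` evaluates the independent term `ν.prod ν` of the joint law.
  have hmean : ∫ x, (R x).real A ∂ν = ν.real A := by
    rw [← setIntegral_univ, ← compProd_real_prod hA .univ, Set.univ_prod,
      ← map_measureReal_apply measurable_snd hA, map_snd_compProd_of_reversible hR hrev]
  have h1 := hX.real_inter_eq hexch hR le_rfl hA hB
  have h2 := hX.real_inter_eq hexch hR (n := 1 + 1) one_le_two hA hB
  have h3 := congrArg (fun μ => μ.real (B ×ˢ A)) (hexch.map_zero_two hX.measurable)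
  simp only [map_measureReal_apply (hm _ _) (hB.prod hA), Set.mk_preimage_prod] at h3
  rw [Finset.sum_range_one, hX.setIntegral_zero hA hB] at h1
  rw [Finset.sum_range_succ (n := 1), Finset.sum_range_one, hX.setIntegral_zero hA hB, h3] at h2
  have h4 := congrArg (fun μ => ∫ p in B ×ˢ Set.univ, (R p.2).real A ∂μ)
    (hX.map_zero_one hexch hR)
  have hBu : MeasurableSet (B ×ˢ (Set.univ : Set E)) := hB.prod .univ
  simp only [Measure.restrict_smul, Measure.restrict_add, integral_smul_measure] at h4
  rw [integral_add_measure
    (hi _ (Measure.smul_finite _ ENNReal.ofReal_ne_top)) (hi _ inferInstance), integral_smul_measure,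
    setIntegral_map hBu (hi _ (by infer_instance)).aestronglyMeasurable (hm 0 1).aemeasurable,
    Measure.setIntegral_compProd hB .univ (hi _ inferInstance).integrableOn,
    setIntegral_prod _ (hi _ inferInstance).integrableOn,
    ENNReal.toReal_ofReal hθ.le, ENNReal.toReal_ofReal (by positivity)] at h4
  simp only [setIntegral_univ, hmean, setIntegral_const, smul_eq_mul, Set.mk_preimage_prod,
    Set.preimage_univ, Set.inter_univ] at h4
  push_cast at h1 h2
  have h5 : (θ + 1) * ((θ + 2) * P.real (X 0 ⁻¹' B ∩ X 1 ⁻¹' A)) =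
      (θ + 2) * ((θ + 1) * P.real (X 0 ⁻¹' B ∩ X 1 ⁻¹' A)) := by ring
  rw [h1, h2] at h5
  linarith

end Predictive

/-! ### The sequence of atoms -/

section Atoms

variable {Ω E : Type*} [MeasurableSpace Ω] {𝒢 : MeasurableSpace E} {mE : MeasurableSpace E}
  [StandardBorelSpace E]
  {P : Measure Ω} [IsProbabilityMeasure P] {θ : ℝ} {ν : Measure E} [IsProbabilityMeasure ν]
  {R : Kernel E E} {X : ℕ → Ω → E}

/-- The indicator of a 𝒢-set is its own conditional expectation given 𝒢. -/
theorem IsConditioning.ae_real_eq_indicator (h : IsConditioning ν R 𝒢)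
    (hR : ∀ᵐ x ∂ν, R x Set.univ = 1) {B : Set E} (hB : MeasurableSet[𝒢] B) :
    ∀ᵐ x ∂ν, (R x).real B = B.indicator 1 x := by
  have h1 := condExpKernel_ae_eq_condExp (μ := ν) h.le (h.le B hB)
  rw [condExp_of_stronglyMeasurable h.le
    ((@stronglyMeasurable_const _ _ 𝒢 _ (1 : ℝ)).indicator hB)
    ((integrable_const (1 : ℝ)).indicator (h.le B hB))] at h1
  filter_upwards [h1, h.ae_eq, hR] with x h1 h2 h3
  rw [h3, inv_one, one_smul] at h2
  rw [h2, h1]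
  rfl

theorem IsConditioning.isPolyaSequence (h : IsConditioning ν R 𝒢) (hX : IsMVPS P θ ν R X)
    (hexch : Exchangeable P X) (hR : ∀ᵐ x ∂ν, R x Set.univ = 1) :
    IsPolyaSequence P θ (atomMeasure ν 𝒢) fun n ω => atomMap 𝒢 (X n ω) := by
  have hπ : Measurable (atomMap 𝒢) := measurable_atomMap h.le
  have hm : ∀ n, Measurable fun ω => atomMap 𝒢 (X n ω) := fun n => hπ.comp (hX.measurable n)
  refine ⟨hX.theta_pos, Measure.isProbabilityMeasure_map hπ.aemeasurable,
    fun x => by rw [Kernel.id_apply]; infer_instance, hm, ?_, fun n hn S hS => ?_⟩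
  · rw [atomMeasure, ← hX.law_zero, Measure.map_map hπ (hX.measurable 0)]
    rfl
  have hB : MeasurableSet[𝒢] (atomMap 𝒢 ⁻¹' S) := hS
  have hle : pastSigma (fun n ω => atomMap 𝒢 (X n ω)) n ≤ pastSigma X n := by
    refine Measurable.comap_le ?_
    exact @measurable_pi_lambda _ _ _ (pastSigma X n) _ _ fun i =>
      hπ.comp (measurable_pastSigma i.2)
  set f : Ω → ℝ := fun ω => (θ * (atomMeasure ν 𝒢).real S +
    ∑ i ∈ Finset.range n, (Kernel.id (atomMap 𝒢 (X i ω))).real S) /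
      (θ + ∑ i ∈ Finset.range n, (Kernel.id (atomMap 𝒢 (X i ω))).real Set.univ) with hf
  have hfm : Measurable[pastSigma (fun n ω => atomMap 𝒢 (X n ω)) n] f := by
    have hk : ∀ T : Set (AtomSpace 𝒢), MeasurableSet T → ∀ i ∈ Finset.range n,
        Measurable[pastSigma (fun n ω => atomMap 𝒢 (X n ω)) n]
          fun ω => (Kernel.id (atomMap 𝒢 (X i ω))).real T := fun T hT i hi =>
      (measurable_real_coe hT).comp
        (measurable_pastSigma (X := fun n ω => atomMap 𝒢 (X n ω)) (Finset.mem_range.1 hi))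
    exact (measurable_const.add (Finset.measurable_fun_sum _ (hk S hS))).div
      (measurable_const.add (Finset.measurable_fun_sum _ (hk _ .univ)))
  have key : P⟦X n ⁻¹' (atomMap 𝒢 ⁻¹' S) | pastSigma X n⟧ =ᵐ[P] f := by
    filter_upwards [hX.predictive_of_ae_univ hexch hR hn (h.le _ hB),
      hX.ae_comp hexch (h.ae_real_eq_indicator hR hB)] with ω h1 h2
    rw [h1, hf]
    simp only [h2, Kernel.id_apply, measureReal_def, atomMeasure, Measure.map_apply hπ hS,
      Measure.dirac_apply' _ hS]
    congr 1
    · congr 1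
      refine Finset.sum_congr rfl fun i _ => ?_
      by_cases hi : atomMap 𝒢 (X i ω) ∈ S <;> simp [hi]
    · simp
  have hfi : Integrable f P := integrable_condExp.congr key
  -- The conditional probability given the larger past of `X` is a.e. `f`, already measurable for
  -- the past of the atoms; conditioning again leaves it unchanged.
  have h1 := (condExp_condExp_of_le (μ := P)
    (f := (X n ⁻¹' (atomMap 𝒢 ⁻¹' S)).indicator fun _ => (1 : ℝ)) hle
    (pastSigma_le hX.measurable n)).symm
  refine h1.trans ((condExp_congr_ae key).trans ?_)
  rw [condExp_of_stronglyMeasurable (pastSigma_le hm n) hfm.stronglyMeasurable hfi]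

end Atoms

end MVPS

theorem mainTheorem9 {Ω 𝕏 : Type*} [MeasurableSpace Ω] [MeasurableSpace 𝕏] [StandardBorelSpace 𝕏]
    (P : Measure Ω) [IsProbabilityMeasure P] (θ : ℝ) (ν : Measure 𝕏) [IsProbabilityMeasure ν]
    (R : Kernel 𝕏 𝕏) (X : ℕ → Ω → 𝕏)
    (hX : MVPS.IsMVPS P θ ν R X) (hexch : MVPS.Exchangeable P X)
    (hcan : MVPS.Canonical R) (hpos : MVPS.StrictlyPositive ν R) :
    (∃ 𝒢 : MeasurableSpace 𝕏, MVPS.IsConditioning ν R 𝒢) ∧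
    ∀ 𝒢 : MeasurableSpace 𝕏, MVPS.IsConditioning ν R 𝒢 →
      MVPS.IsPolyaSequence P θ (MVPS.atomMeasure ν 𝒢) (fun n ω => MVPS.atomMap 𝒢 (X n ω)) := by
  have := hcan.isFiniteKernel
  have hR := hcan.ae_univ_eq_one hpos
  exact ⟨MVPS.exists_isConditioning_of_reversible_idempotent hR (hX.reversible hexch hR)
    fun A hA => hX.idempotent hexch hR hA, fun 𝒢 h => h.isPolyaSequence hX hexch hR⟩
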